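/- Let $d$ be a dimension, let $E=\{\{x,y\}: x,y\in\mathbb Z^d,\ x\neq y\}$ be the set of undirected edges between distinct sites of $\mathbb Z^d$, and let $\Omega=[0,\infty]^E$ carry the product $\sigma$-algebra. For $x\in\mathbb Z^d$ let $\tau_x:\Omega\to\Omega$ be the translation $(\tau_x\omega)(\{y,z\})=\omega(\{y+x,z+x\})$. Let $\mathbb P$ be a probability measure on $\Omega$ that is stationary and ergodic with respect to $(\tau_x)_{x\in\mathbb Z^d}$, with expectation $\mathbb E$. Put $Q=(-1,1)^d$ and, for $\varepsilon>0$, $Q_\varepsilon=Q\cap\varepsilon\mathbb Z^d$; for $v:\varepsilon\mathbb Z^d\to\mathbb R$ put $$\mathcal R_\varepsilon^* v=\sum_{z\in\varepsilon\mathbb Z^d} v(z)\,\mathbf 1_{z+(-\varepsilon/2,\varepsilon/2]^d}.$$ Theorem (generalized ergodic theorem). For every $f\in L^1(\Omega,\mathbb P)$, for $\mathbb P$-almost every $\omega\in\Omega$ the following holds. Let $S\subseteq(0,\infty)$ be a set of scales that accumulates at $0$ (for instance $S=(0,\infty)$, $S=\{1/n:n\in\mathbb N,\ n\ge 1\}$,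 or the set of values of a sequence of positive numbers converging to $0$), and let $(u^\varepsilon)_{\varepsilon\in S}$ be functions $u^\varepsilon:\varepsilon\mathbb Z^d\to\mathbb R$ with support in $Q_\varepsilon$ such that $\sup_{\varepsilon\in S}\|u^\varepsilon\|_\infty<\infty$ and such that, as $\varepsilon\to0$ in $S$, $\mathcal R_\varepsilon^*u^\varepsilon\to u$ pointwise a.e. in $Q$ for some function $u:Q\to\mathbb R$. Then $u\in L^\infty(Q)$ and $$\lim_{\varepsilon\to0,\ \varepsilon\in S}\ \varepsilon^d\sum_{x\in\varepsilon^{-1}Q_\varepsilon}u^\varepsilon(\varepsilon x)\,f(\tau_x\omega)=\mathbb E[f]\int_Q u(x)\,dx .$$ The exceptional null set depends on $f$ but not on $S$, on the functions $u^\varepsilon$ or on $u$. -/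

import Mathlib

open MeasureTheory Filter Topology
open scoped ENNReal

namespace RandomConductance

/-- Undirected edges `{x, y}`, `x ≠ y`, between any two distinct sites of `ℤ^d`. -/
abbrev Edge (d : ℕ) : Type := {e : Sym2 (Fin d → ℤ) // ¬ e.IsDiag}

/-- The edge `{x + a, y + a}` obtained from `{x, y}` by translation by `a`. -/
def Edge.shift {d : ℕ} (a : Fin d → ℤ) (e : Edge d) : Edge d :=
  ⟨e.1.map (fun x => x + a), by
    rw [Sym2.isDiag_map (add_left_injective a)]
    exact e.2⟩

theorem Edge.shift_zero {d : ℕ} (e : Edge d) : Edge.shift 0 e = e := by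
  apply Subtype.ext
  simp [Edge.shift]

theorem Edge.shift_add {d : ℕ} (a b : Fin d → ℤ) (e : Edge d) :
    Edge.shift (a + b) e = Edge.shift b (Edge.shift a e) := by
  apply Subtype.ext
  simp [Edge.shift, Sym2.map_map, add_assoc]

/-- The space `Ω = [0, ∞]^E` of environments. -/
def Env (d : ℕ) : Type := Edge d → ℝ≥0∞

/-- The product σ-algebra of the Borel σ-algebra of `[0, ∞]`. -/
instance (d : ℕ) : MeasurableSpace (Env d) :=
  inferInstanceAs (MeasurableSpace (Edge d → ℝ≥0∞))

/-- The translations `τ_a`, written `a +ᵥ ω`: `(τ_a ω)({x, y}) = ω({x + a, y + a})`. -/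
instance (d : ℕ) : AddAction (Fin d → ℤ) (Env d) where
  vadd a ω := fun e => ω (Edge.shift a e)
  zero_vadd ω := funext fun e => congrArg ω (Edge.shift_zero e)
  add_vadd a b ω := funext fun e => congrArg ω (Edge.shift_add a b e)

/-- The box `Q = (-1, 1)^d`. -/
def box (d : ℕ) : Set (Fin d → ℝ) := Set.pi Set.univ fun _ => Set.Ioo (-1) 1

/-- The rescaled lattice `ε ℤ^d`, as a subset of `ℝ^d`. -/
def scaledLattice (d : ℕ) (ε : ℝ) : Set (Fin d → ℝ) :=
  Set.range fun (x : Fin d → ℤ) (i : Fin d) => ε * (x i : ℝ)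

/-- The point `ε x` of `ε ℤ^d`, for `x ∈ ℤ^d`. -/
def scalePoint {d : ℕ} (ε : ℝ) (x : Fin d → ℤ) : scaledLattice d ε :=
  ⟨fun i => ε * (x i : ℝ), Set.mem_range_self x⟩

/-- The discrete box `Q_ε = Q ∩ ε ℤ^d`. -/
def discreteBox (d : ℕ) (ε : ℝ) : Set (scaledLattice d ε) :=
  {z | (z : Fin d → ℝ) ∈ box d}

/-- The half-open cell `z + (-ε/2, ε/2]^d`. -/
def cell {d : ℕ} (ε : ℝ) (z : Fin d → ℝ) : Set (Fin d → ℝ) :=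
  Set.pi Set.univ fun i => Set.Ioc (z i - ε / 2) (z i + ε / 2)

/-- The piecewise constant extension `R_ε^* v = ∑_{z ∈ ε ℤ^d} v(z) 1_{z + (-ε/2, ε/2]^d}`.
For `ε > 0` the cells partition `ℝ^d`, so that at each point exactly one of the
indicators is nonzero. -/
noncomputable def cellExtend {d : ℕ} (ε : ℝ) (v : scaledLattice d ε → ℝ) (y : Fin d → ℝ) : ℝ :=
  ∑ᶠ z : scaledLattice d ε, v z * (cell ε (z : Fin d → ℝ)).indicator (fun _ => (1 : ℝ)) y

/-- The weighted ergodic sum `ε^d ∑_{x ∈ ε⁻¹ Q_ε} v(ε x) f(τ_x ω)`; for `ε > 0` the sum is over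
the finitely many `x ∈ ℤ^d` with `ε x ∈ Q`. -/
noncomputable def ergodicSum {d : ℕ} (f : Env d → ℝ) (ω : Env d) (ε : ℝ)
    (v : scaledLattice d ε → ℝ) : ℝ :=
  ε ^ d * ∑ᶠ x ∈ {x : Fin d → ℤ | scalePoint ε x ∈ discreteBox d ε},
    v (scalePoint ε x) * f (x +ᵥ ω)

end RandomConductance

open RandomConductance

/-! Call an observable good if the limit holds almost surely for all weight families at once. The
good observables are shown to contain constants and bounded coboundaries, to be closed in `L¹`, and
hence to exhaust `L¹`.

The weights enter only through two facts. By dominated convergence `R_ε^* u^ε` converges to `1_Q u`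
in `L¹(ℝ^d)` (`tendsto_integral_abs_sub`), and a lattice sum times `ε^d` is the integral of a step
function. This settles constants. For `g ∘ τ_a - g` with `g` bounded, summation by parts moves the
difference onto the weights. The sum is then at most `sup |g|` times the `L¹` distance between
`R_ε^* u^ε` and its translate by `ε a`, which vanishes because translations are continuous in `L¹`.
Neither case has an exceptional set.

Closedness (`of_forall_approx`) follows from a maximal inequality and Borel–Cantelli: the error of
an approximation is controlled by cube averages of `|f - g_k|` and the uniform bound on the weights,
so the null set depends only on `f` and a countable choice of `g_k`.

Finally, in `L²`, a function orthogonal to the good ones is invariant, hence constant by ergodicity,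
hence zero (`submodule_orthogonal_eq_bot`). Density carries `L²` to `L¹`. -/

namespace RandomConductance

/-! ### Lattice sums as integrals of step functions -/

/-- The index `x ∈ ℤ^d` of the cell `ε x + (-ε/2, ε/2]^d` that contains `y`. -/
noncomputable def cellIndex {d : ℕ} (ε : ℝ) (y : Fin d → ℝ) : Fin d → ℤ :=
  fun i => ⌈y i / ε - 1 / 2⌉

theorem mem_cell_scalePoint_iff {d : ℕ} {ε : ℝ} (hε : 0 < ε) (x : Fin d → ℤ) (y : Fin d → ℝ) :
    y ∈ cell ε (scalePoint ε x : Fin d → ℝ) ↔ cellIndex ε y = x := by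
  simp only [cell, scalePoint, Set.mem_pi, Set.mem_univ, true_imp_iff, Set.mem_Ioc, funext_iff,
    cellIndex, Int.ceil_eq_iff]
  refine forall_congr' fun i => ?_
  rw [lt_sub_iff_add_lt, sub_le_iff_le_add, lt_div_iff₀ hε, div_le_iff₀ hε]
  constructor <;> rintro ⟨h₁, h₂⟩ <;> constructor <;> linarith

theorem abs_sub_cellIndex_le {d : ℕ} {ε : ℝ} (hε : 0 < ε) (y : Fin d → ℝ) (i : Fin d) :
    |y i - ε * cellIndex ε y i| ≤ ε / 2 := by
  have := (mem_cell_scalePoint_iff hε _ y).2 rfl i trivial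
  simp only [scalePoint, Set.mem_Ioc] at this
  rw [abs_le]
  constructor <;> linarith [this.1, this.2]

theorem cellExtend_eq {d : ℕ} {ε : ℝ} (hε : 0 < ε) (v : scaledLattice d ε → ℝ) (y : Fin d → ℝ) :
    cellExtend ε v y = v (scalePoint ε (cellIndex ε y)) := by
  rw [cellExtend, finsum_eq_single _ (scalePoint ε (cellIndex ε y))]
  · rw [Set.indicator_of_mem ((mem_cell_scalePoint_iff hε _ y).2 rfl), mul_one]
  · rintro ⟨_, x, rfl⟩ hx
    rw [Set.indicator_of_notMem, mul_zero]
    intro hy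
    exact hx (congrArg (scalePoint ε) ((mem_cell_scalePoint_iff hε x y).1 hy).symm)

theorem measurable_cellIndex {d : ℕ} (ε : ℝ) : Measurable (cellIndex (d := d) ε) :=
  measurable_pi_lambda _ fun i => by
    have : Measurable fun y : Fin d → ℝ => y i / ε - 1 / 2 := by fun_prop
    exact Int.measurable_ceil.comp this

theorem cellIndex_sub {d : ℕ} {ε : ℝ} (hε : 0 < ε) (a : Fin d → ℤ) (y : Fin d → ℝ) :
    cellIndex ε (y - fun i => ε * (a i : ℝ)) = cellIndex ε y - a := by
  ext i
  simp only [cellIndex, Pi.sub_apply]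
  rw [← Int.ceil_sub_intCast]
  congr 1
  field_simp
  ring

theorem volume_cellIndex_preimage {d : ℕ} {ε : ℝ} (hε : 0 < ε) (x : Fin d → ℤ) :
    volume (cellIndex ε ⁻¹' {x}) = ENNReal.ofReal (ε ^ d) := by
  have : cellIndex ε ⁻¹' {x} = cell ε (scalePoint ε x : Fin d → ℝ) := by
    ext y
    exact (mem_cell_scalePoint_iff hε x y).symm
  rw [this, cell, Real.volume_pi_Ioc]
  simp only [add_sub_sub_cancel, add_halves, Finset.prod_const, Finset.card_univ, Fintype.card_fin]
  exact (ENNReal.ofReal_pow hε.le d).symm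

/-- Every cell has volume `ε^d`. This is the dictionary that makes `L¹(ℝ^d)` arguments available for
lattice sums. -/
theorem integrable_and_integral_comp_cellIndex {d : ℕ} {ε : ℝ} (hε : 0 < ε) {a : (Fin d → ℤ) → ℝ}
    (ha : a.support.Finite) :
    Integrable (fun y => a (cellIndex ε y)) ∧
      ∫ y, a (cellIndex ε y) = ε ^ d * ∑ᶠ x, a x := by
  have h : (fun y => a (cellIndex ε y)) = fun y => ∑ x ∈ ha.toFinset,
      (cellIndex ε ⁻¹' {x}).indicator (fun _ => a x) y := by
    ext y
    by_cases hy : a (cellIndex ε y) = 0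
    · rw [hy, Finset.sum_eq_zero]
      intro x _
      rw [Set.indicator_apply_eq_zero]
      rintro rfl
      exact hy
    · rw [Finset.sum_eq_single_of_mem (cellIndex ε y) (by simpa using hy)]
      · simp
      · intro x _ hx
        exact Set.indicator_of_notMem (fun h => hx h.symm) _
  have hm (x : Fin d → ℤ) : MeasurableSet (cellIndex ε ⁻¹' {x}) :=
    measurable_cellIndex ε (MeasurableSet.singleton x)
  have hi (x : Fin d → ℤ) :
      Integrable ((cellIndex ε ⁻¹' {x}).indicator fun _ => a x) := by
    refine (integrable_indicator_iff (hm x)).2 (integrableOn_const ?_)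
    rw [volume_cellIndex_preimage hε]
    exact ENNReal.ofReal_ne_top
  rw [h]
  refine ⟨integrable_finsetSum _ fun x _ => hi x, ?_⟩
  rw [integral_finsetSum _ fun x _ => hi x, finsum_eq_sum _ ha, Finset.mul_sum]
  refine Finset.sum_congr rfl fun x _ => ?_
  rw [integral_indicator_const _ (hm x), measureReal_def, volume_cellIndex_preimage hε,
    ENNReal.toReal_ofReal (pow_nonneg hε.le d), smul_eq_mul]

theorem integral_norm_translate_tendsto_zero {d : ℕ} {w : (Fin d → ℝ) → ℝ} (hw : Integrable w) :
    Tendsto (fun t : Fin d → ℝ => ∫ y, |w (y - t) - w y|) (𝓝 0) (𝓝 0) := by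
  have : Fact ((1 : ℝ≥0∞) ≠ ∞) := ⟨ENNReal.one_ne_top⟩
  set f := (memLp_one_iff_integrable.2 hw).toLp w with hf
  -- The domain action by `s` replaces `y` by `s + y`, hence the sign.
  have hc : Continuous fun t : Fin d → ℝ => DomAddAct.mk (-t) +ᵥ f :=
    (DomAddAct.continuous_mk.comp continuous_neg).vadd continuous_const
  have h := tendsto_iff_norm_sub_tendsto_zero.1 (hc.tendsto 0)
  refine h.congr fun t => ?_
  rw [L1.norm_eq_integral_norm]
  refine integral_congr_ae ?_
  have h0 : DomAddAct.mk (-(0 : Fin d → ℝ)) +ᵥ f = f := by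
    rw [neg_zero, DomAddAct.mk_zero, zero_vadd]
  have hft : (DomAddAct.mk (-t) +ᵥ f : Lp ℝ 1 volume) =ᵐ[volume] fun y => w (y - t) := by
    rw [hf, DomAddAct.mk_vadd_toLp]
    refine (MemLp.coeFn_toLp _).trans (Eventually.of_forall fun y => ?_)
    simp only [vadd_eq_add, neg_add_eq_sub]
  rw [h0]
  filter_upwards [Lp.coeFn_sub (DomAddAct.mk (-t) +ᵥ f) f, hft, MemLp.coeFn_toLp
    (memLp_one_iff_integrable.2 hw)] with y h₁ h₂ h₃
  rw [h₁, Pi.sub_apply, h₂, hf, h₃, Real.norm_eq_abs]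

theorem measurableSet_box (d : ℕ) : MeasurableSet (box d) :=
  MeasurableSet.univ_pi fun _ => measurableSet_Ioo

/-! ### Weights at a fixed scale -/

/-- The hypotheses on a family of weights `u^ε` with limit `u₀` in the ergodic theorem. -/
structure IsWeightFamily {d : ℕ} (S : Set ℝ) (u : (ε : ℝ) → scaledLattice d ε → ℝ)
    (u₀ : (Fin d → ℝ) → ℝ) : Prop where
  pos : S ⊆ Set.Ioi 0
  neBot : (𝓝[S] (0 : ℝ)).NeBot
  support_subset : ∀ ε ∈ S, Function.support (u ε) ⊆ discreteBox d ε
  tendsto : ∀ᵐ y ∂(volume.restrict (box d)),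
    Tendsto (fun ε => cellExtend ε (u ε) y) (𝓝[S] 0) (𝓝 (u₀ y))
  bounded : ∃ C : ℝ, ∀ ε ∈ S, ∀ z : scaledLattice d ε, |u ε z| ≤ C

theorem finite_setOf_scalePoint_mem_discreteBox (d : ℕ) {ε : ℝ} (hε : 0 < ε) :
    {x : Fin d → ℤ | scalePoint ε x ∈ discreteBox d ε}.Finite := by
  refine (Set.finite_Icc (fun _ => -⌊1 / ε⌋) (fun _ => ⌊1 / ε⌋)).subset fun x hx => ?_
  simp only [discreteBox, box, scalePoint, Set.mem_ofPred_eq, Set.mem_pi, Set.mem_univ,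
    true_imp_iff, Set.mem_Ioo] at hx
  constructor <;> intro i
  · rw [neg_le, Int.le_floor, le_div_iff₀ hε]
    push_cast
    linarith [(hx i).1]
  · rw [Int.le_floor, le_div_iff₀ hε]
    linarith [(hx i).2]

section

variable {d : ℕ} {ε : ℝ} {v : scaledLattice d ε → ℝ}

theorem finite_support_comp_scalePoint (hε : 0 < ε) (hv : v.support ⊆ discreteBox d ε) :
    (fun x => v (scalePoint ε x)).support.Finite :=
  (finite_setOf_scalePoint_mem_discreteBox d hε).subset fun _ hx => hv hx

theorem ergodicSum_eq_finsum (f : Env d → ℝ) (ω : Env d) (hv : v.support ⊆ discreteBox d ε) :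
    ergodicSum f ω ε v = ε ^ d * ∑ᶠ x, v (scalePoint ε x) * f (x +ᵥ ω) := by
  rw [ergodicSum]
  congr 1
  rw [← finsum_mem_univ fun x => v (scalePoint ε x) * f (x +ᵥ ω)]
  refine finsum_mem_inter_support_eq _ _ _ ?_
  rw [Set.univ_inter, Set.inter_eq_right]
  intro x hx
  exact hv (left_ne_zero_of_mul hx)

theorem ergodicSum_add (f g : Env d → ℝ) (ω : Env d) (hε : 0 < ε) :
    ergodicSum (fun ω => f ω + g ω) ω ε v = ergodicSum f ω ε v + ergodicSum g ω ε v := by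
  simp only [ergodicSum, mul_add]
  rw [finsum_mem_add_distrib (finite_setOf_scalePoint_mem_discreteBox d hε), mul_add]

theorem ergodicSum_const_mul (c : ℝ) (f : Env d → ℝ) (ω : Env d) :
    ergodicSum (fun ω => c * f ω) ω ε v = c * ergodicSum f ω ε v := by
  simp only [ergodicSum]
  simp only [mul_left_comm _ c]
  rw [← mul_finsum_mem, mul_left_comm]

/-- Cells centred in `Q` stick out of it by at most `ε/2`. -/
theorem cellExtend_eq_zero_of_one_add_le (hε : 0 < ε) (hv : v.support ⊆ discreteBox d ε)
    {y : Fin d → ℝ} {i : Fin d} (hy : 1 + ε / 2 ≤ |y i|) : cellExtend ε v y = 0 := by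
  rw [cellExtend_eq hε]
  by_contra h
  have h₁ := hv h i trivial
  simp only [scalePoint, Set.mem_Ioo] at h₁
  have h₂ := abs_sub_cellIndex_le hε y i
  have h₃ := abs_lt.2 h₁
  have h₄ := abs_sub_abs_le_abs_sub (y i) (ε * cellIndex ε y i)
  linarith

theorem measurable_cellExtend (hε : 0 < ε) : Measurable (cellExtend ε v) := by
  rw [funext (cellExtend_eq hε v)]
  exact (Measurable.of_discrete (f := fun x => v (scalePoint ε x))).comp (measurable_cellIndex ε)

theorem integrable_cellExtend (hε : 0 < ε) (hv : v.support ⊆ discreteBox d ε) :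
    Integrable (cellExtend ε v) := by
  rw [funext (cellExtend_eq hε v)]
  exact (integrable_and_integral_comp_cellIndex hε (finite_support_comp_scalePoint hε hv)).1

theorem integral_cellExtend (hε : 0 < ε) (hv : v.support ⊆ discreteBox d ε) :
    ∫ y, cellExtend ε v y = ε ^ d * ∑ᶠ x, v (scalePoint ε x) := by
  rw [funext (cellExtend_eq hε v)]
  exact (integrable_and_integral_comp_cellIndex hε (finite_support_comp_scalePoint hε hv)).2

/-- Summation by parts for weighted sums of a bounded coboundary. -/
theorem abs_ergodicSum_coboundary_le (hε : 0 < ε) (hv : v.support ⊆ discreteBox d ε)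
    {g : Env d → ℝ} {M : ℝ} (hM : ∀ ω, |g ω| ≤ M) (a : Fin d → ℤ) (ω : Env d) :
    |ergodicSum (fun ω => g (a +ᵥ ω) - g ω) ω ε v| ≤
      M * ∫ y, |cellExtend ε v (y - fun i => ε * (a i : ℝ)) - cellExtend ε v y| := by
  have hfin := finite_support_comp_scalePoint hε hv
  set V : (Fin d → ℤ) → ℝ := fun x => v (scalePoint ε x) with hV
  have hfin' : (fun x => V (x - a)).support.Finite :=
    hfin.preimage (sub_left_injective (b := a)).injOn
  have hfin_sub : (fun x => V (x - a) - V x).support.Finite :=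
    (hfin'.union hfin).subset (Function.support_sub _ _)
  have hfin_abs : (fun x => |V (x - a) - V x|).support.Finite :=
    hfin_sub.subset fun x hx => by simpa using hx
  -- A `finsum` with infinite support is `0` by convention, so each splitting below needs finite
  -- supports.
  have hmul {b : (Fin d → ℤ) → ℝ} (hb : b.support.Finite) (c : (Fin d → ℤ) → ℝ) :
      (fun x => b x * c x).support.Finite :=
    hb.subset fun x hx => left_ne_zero_of_mul hx
  have hsum : ∑ᶠ x, V x * (g (a +ᵥ x +ᵥ ω) - g (x +ᵥ ω)) =
      ∑ᶠ x, (V (x - a) - V x) * g (x +ᵥ ω) := by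
    simp only [mul_sub, sub_mul]
    rw [finsum_sub_distrib (hmul hfin _) (hmul hfin _),
      finsum_sub_distrib (hmul hfin' _) (hmul hfin _)]
    congr 1
    -- Reindexing by `x ↦ x + a` moves the shift from the observable to the weights.
    rw [← finsum_comp_equiv (Equiv.addRight a) (f := fun x => V (x - a) * g (x +ᵥ ω))]
    refine finsum_congr fun x => ?_
    simp only [Equiv.coe_addRight, add_sub_cancel_right]
    rw [add_comm x a, add_vadd]
  have hint : ∫ y, |cellExtend ε v (y - fun i => ε * (a i : ℝ)) - cellExtend ε v y| =
      ε ^ d * ∑ᶠ x, |V (x - a) - V x| := by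
    rw [← (integrable_and_integral_comp_cellIndex hε hfin_abs).2]
    simp only [cellExtend_eq hε, cellIndex_sub hε, hV]
  rw [ergodicSum_eq_finsum _ _ hv, hsum, hint, abs_mul, abs_of_nonneg (pow_nonneg hε.le d),
    mul_left_comm]
  gcongr
  rw [finsum_eq_sum_of_support_subset _ (s := hfin_abs.toFinset), mul_comm,
    finsum_eq_sum _ hfin_abs, Finset.sum_mul]
  · refine (Finset.abs_sum_le_sum_abs _ _).trans (Finset.sum_le_sum fun x _ => ?_)
    rw [abs_mul]
    gcongr
    exact hM _
  · intro x hx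
    simpa using left_ne_zero_of_mul hx

end

/-! ### Convergence of weight families, constants and coboundaries -/

namespace IsWeightFamily

variable {d : ℕ} {S : Set ℝ} {u : (ε : ℝ) → scaledLattice d ε → ℝ} {u₀ : (Fin d → ℝ) → ℝ}

theorem exists_bound (h : IsWeightFamily S u u₀) :
    ∃ C : ℝ, 0 ≤ C ∧ ∀ ε ∈ S, ∀ z : scaledLattice d ε, |u ε z| ≤ C :=
  let ⟨C, hC⟩ := h.bounded
  ⟨|C|, abs_nonneg C, fun ε hε z => (hC ε hε z).trans (le_abs_self C)⟩

theorem eventually_mem (_ : IsWeightFamily S u u₀) : ∀ᶠ ε in 𝓝[S] (0 : ℝ), ε ∈ S :=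
  self_mem_nhdsWithin

theorem abs_cellExtend_le (h : IsWeightFamily S u u₀) {C : ℝ}
    (hC : ∀ ε ∈ S, ∀ z : scaledLattice d ε, |u ε z| ≤ C) {ε : ℝ} (hε : ε ∈ S) (y : Fin d → ℝ) :
    |cellExtend ε (u ε) y| ≤ C := by
  rw [cellExtend_eq (h.pos hε)]
  exact hC ε hε _

theorem abs_limit_le (h : IsWeightFamily S u u₀) {C : ℝ}
    (hC : ∀ ε ∈ S, ∀ z : scaledLattice d ε, |u ε z| ≤ C) :
    ∀ᵐ y ∂(volume.restrict (box d)), |u₀ y| ≤ C := by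
  have := h.neBot
  filter_upwards [h.tendsto] with y hy
  exact le_of_tendsto hy.abs (h.eventually_mem.mono fun ε hε => h.abs_cellExtend_le hC hε y)

theorem aestronglyMeasurable_limit (h : IsWeightFamily S u u₀) :
    AEStronglyMeasurable u₀ (volume.restrict (box d)) := by
  have := h.neBot
  -- Measurability passes to limits of sequences. The shift by `N` below keeps all scales in `S`,
  -- hence positive.
  obtain ⟨s, hs⟩ := exists_seq_tendsto (𝓝[S] (0 : ℝ))
  obtain ⟨N, hN⟩ := eventually_atTop.1 (hs.eventually h.eventually_mem)
  refine aestronglyMeasurable_of_tendsto_ae (u := atTop)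
    (f := fun n y => cellExtend (s (n + N)) (u (s (n + N))) y)
    (fun n => (measurable_cellExtend (h.pos (hN _ (by omega)))).aestronglyMeasurable) ?_
  filter_upwards [h.tendsto] with y hy
  exact hy.comp (hs.comp (tendsto_add_atTop_nat N))

theorem memLp_top (h : IsWeightFamily S u u₀) : MemLp u₀ ∞ (volume.restrict (box d)) := by
  obtain ⟨C, -, hC⟩ := h.exists_bound
  exact memLp_top_of_bound h.aestronglyMeasurable_limit C (h.abs_limit_le hC)

theorem integrable_indicator_limit (h : IsWeightFamily S u u₀) :
    Integrable ((box d).indicator u₀) := by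
  rw [integrable_indicator_iff (measurableSet_box d)]
  have : IsFiniteMeasure (volume.restrict (box d)) := by
    refine ⟨?_⟩
    rw [Measure.restrict_apply_univ, box, Real.volume_pi_Ioo]
    exact ENNReal.prod_lt_top fun _ _ => ENNReal.ofReal_lt_top
  exact h.memLp_top.integrable le_top

/-- Off the closed cube the extensions vanish once `ε` is small, and the boundary of `Q` is a null
set. -/
theorem ae_tendsto_indicator (h : IsWeightFamily S u u₀) :
    ∀ᵐ y, Tendsto (fun ε => cellExtend ε (u ε) y) (𝓝[S] 0) (𝓝 ((box d).indicator u₀ y)) := by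
  have hb : box d =ᵐ[volume] Set.Icc (fun _ => -1) (fun _ => 1) :=
    Measure.univ_pi_Ioo_ae_eq_Icc
  filter_upwards [(ae_restrict_iff' (measurableSet_box d)).1 h.tendsto, hb.mem_iff] with y h₁ h₂
  by_cases hy : y ∈ box d
  · rw [Set.indicator_of_mem hy]
    exact h₁ hy
  · rw [Set.indicator_of_notMem hy]
    obtain ⟨i, hi⟩ : ∃ i, 1 < |y i| := by
      by_contra! hcon
      exact hy (h₂.2 ⟨fun i => (abs_le.1 (hcon i)).1, fun i => (abs_le.1 (hcon i)).2⟩)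
    refine tendsto_const_nhds.congr' ?_
    have : ∀ᶠ ε in 𝓝[S] (0 : ℝ), ε < 2 * (|y i| - 1) :=
      nhdsWithin_le_nhds (Iio_mem_nhds (by linarith))
    filter_upwards [this, h.eventually_mem] with ε hε hεS
    exact (cellExtend_eq_zero_of_one_add_le (h.pos hεS) (h.support_subset ε hεS)
      (i := i) (by linarith)).symm

theorem tendsto_integral_abs_sub (h : IsWeightFamily S u u₀) :
    Tendsto (fun ε => ∫ y, |cellExtend ε (u ε) y - (box d).indicator u₀ y|) (𝓝[S] 0) (𝓝 0) := by
  obtain ⟨C, hC0, hC⟩ := h.exists_bound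
  have hlim : Tendsto (fun ε => ∫ y, |cellExtend ε (u ε) y - (box d).indicator u₀ y|) (𝓝[S] 0)
      (𝓝 (∫ _ : Fin d → ℝ, (0 : ℝ))) := by
    -- For `ε < 1` the extensions live in `[-2, 2]^d`, since `1 + ε/2 < 2`.
    refine tendsto_integral_filter_of_dominated_convergence
      (fun y => (Set.Icc (fun _ : Fin d => (-2 : ℝ)) fun _ => 2).indicator (fun _ => C) y +
        |(box d).indicator u₀ y|) ?_ ?_ ?_ ?_
    · filter_upwards [h.eventually_mem] with ε hε
      exact ((measurable_cellExtend (h.pos hε)).aestronglyMeasurable.sub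
        h.integrable_indicator_limit.aestronglyMeasurable).norm
    · filter_upwards [h.eventually_mem,
        nhdsWithin_le_nhds (Iio_mem_nhds (zero_lt_one (α := ℝ)))] with ε hε hε1
      refine Eventually.of_forall fun y => ?_
      rw [Real.norm_eq_abs, abs_abs]
      refine (abs_sub _ _).trans (add_le_add_left ?_ _)
      by_cases hy : y ∈ Set.Icc (fun _ : Fin d => (-2 : ℝ)) fun _ => 2
      · rw [Set.indicator_of_mem hy]
        exact h.abs_cellExtend_le hC hε y
      · rw [Set.indicator_of_notMem hy]
        obtain ⟨i, hi⟩ : ∃ i, 2 < |y i| := by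
          by_contra! hcon
          exact hy ⟨fun i => (abs_le.1 (hcon i)).1, fun i => (abs_le.1 (hcon i)).2⟩
        rw [cellExtend_eq_zero_of_one_add_le (h.pos hε) (h.support_subset ε hε) (i := i), abs_zero]
        linarith [Set.mem_Iio.1 hε1]
    · refine Integrable.add ?_ h.integrable_indicator_limit.abs
      exact (integrable_indicator_iff measurableSet_Icc).2
        (integrableOn_const isCompact_Icc.measure_lt_top.ne)
    · filter_upwards [h.ae_tendsto_indicator] with y hy
      simpa using (hy.sub_const ((box d).indicator u₀ y)).abs
  simpa using hlim

theorem tendsto_ergodicSum_const (h : IsWeightFamily S u u₀) (c : ℝ) (ω : Env d) :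
    Tendsto (fun ε => ergodicSum (fun _ => c) ω ε (u ε)) (𝓝[S] 0)
      (𝓝 (c * ∫ y in box d, u₀ y)) := by
  have hI : Tendsto (fun ε => ∫ y, cellExtend ε (u ε) y) (𝓝[S] 0)
      (𝓝 (∫ y, (box d).indicator u₀ y)) := by
    rw [tendsto_iff_norm_sub_tendsto_zero]
    refine squeeze_zero' (Eventually.of_forall fun _ => norm_nonneg _) ?_
      h.tendsto_integral_abs_sub
    filter_upwards [h.eventually_mem] with ε hε
    rw [← integral_sub (integrable_cellExtend (h.pos hε) (h.support_subset ε hε))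
      h.integrable_indicator_limit]
    exact norm_integral_le_integral_norm _
  rw [integral_indicator (measurableSet_box d)] at hI
  refine (hI.const_mul c).congr' ?_
  filter_upwards [h.eventually_mem] with ε hε
  rw [integral_cellExtend (h.pos hε) (h.support_subset ε hε),
    ergodicSum_eq_finsum _ _ (h.support_subset ε hε), ← finsum_mul, mul_left_comm, mul_comm c]

theorem tendsto_ergodicSum_coboundary (h : IsWeightFamily S u u₀) {g : Env d → ℝ} {M : ℝ}
    (hM : ∀ ω, |g ω| ≤ M) (a : Fin d → ℤ) (ω : Env d) :
    Tendsto (fun ε => ergodicSum (fun ω => g (a +ᵥ ω) - g ω) ω ε (u ε)) (𝓝[S] 0) (𝓝 0) := by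
  set w := (box d).indicator u₀ with hw
  set t : ℝ → Fin d → ℝ := fun ε i => ε * (a i : ℝ) with ht
  have htend : Tendsto t (𝓝[S] 0) (𝓝 0) := by
    have : Continuous t := by fun_prop
    have h0 : t 0 = 0 := by ext; simp [ht]
    exact h0 ▸ (this.tendsto 0).mono_left nhdsWithin_le_nhds
  have h₁ := (integral_norm_translate_tendsto_zero h.integrable_indicator_limit).comp htend
  -- Comparing with the fixed limit `w` costs its distance to the extension twice, once translated
  -- and once not; what remains is the translation error of `w` alone.
  have h₂ := ((h.tendsto_integral_abs_sub.const_mul 2).add h₁).const_mul M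
  simp only [mul_zero, add_zero] at h₂
  refine squeeze_zero_norm' ?_ h₂
  filter_upwards [h.eventually_mem] with ε hε
  have hM0 : 0 ≤ M := (abs_nonneg _).trans (hM ω)
  refine (abs_ergodicSum_coboundary_le (h.pos hε) (h.support_subset ε hε) hM a ω).trans
    (mul_le_mul_of_nonneg_left ?_ hM0)
  have hi := integrable_cellExtend (h.pos hε) (h.support_subset ε hε)
  have hd : Integrable fun y => |cellExtend ε (u ε) y - w y| :=
    (hi.sub h.integrable_indicator_limit).abs
  have hdd : Integrable fun y => |cellExtend ε (u ε) (y - t ε) - w (y - t ε)| +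
      |cellExtend ε (u ε) y - w y| := (hd.comp_sub_right (t ε)).add hd
  have hwt : Integrable fun y => |w (y - t ε) - w y| :=
    ((h.integrable_indicator_limit.comp_sub_right (t ε)).sub h.integrable_indicator_limit).abs
  have hdt : ∫ y, |cellExtend ε (u ε) (y - t ε) - w (y - t ε)| =
      ∫ y, |cellExtend ε (u ε) y - w y| :=
    integral_sub_right_eq_self (fun y => |cellExtend ε (u ε) y - w y|) (t ε)
  simp only [Function.comp_apply]
  rw [two_mul, ← hw]
  nth_rewrite 1 [← hdt]
  rw [← integral_add (hd.comp_sub_right (t ε)) hd, ← integral_add hdd hwt]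
  refine integral_mono ((hi.comp_sub_right (t ε)).sub hi).abs
    (hdd.add hwt) fun y => ?_
  have e : cellExtend ε (u ε) (y - t ε) - cellExtend ε (u ε) y =
    (cellExtend ε (u ε) (y - t ε) - w (y - t ε)) - (cellExtend ε (u ε) y - w y) +
      (w (y - t ε) - w y) := by ring
  beta_reduce
  rw [e]
  exact (abs_add_le _ _).trans (add_le_add_left (abs_sub _ _) _)

end IsWeightFamily

/-! ### The maximal inequality -/

/-- The discrete cube of radius `n` around `x`. -/
noncomputable def cube {d : ℕ} (x : Fin d → ℤ) (n : ℕ) : Finset (Fin d → ℤ) :=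
  Finset.Icc (fun i => x i - n) fun i => x i + n

theorem mem_cube {d : ℕ} {x y : Fin d → ℤ} {n : ℕ} :
    y ∈ cube x n ↔ ∀ i, |y i - x i| ≤ n := by
  simp only [cube, Finset.mem_Icc, Pi.le_def, ← forall_and, abs_le]
  exact forall_congr' fun i => by constructor <;> rintro ⟨h₁, h₂⟩ <;> constructor <;> linarith

theorem card_cube {d : ℕ} (x : Fin d → ℤ) (n : ℕ) : (cube x n).card = (2 * n + 1) ^ d := by
  rw [cube, Pi.card_Icc]
  simp only [Int.card_Icc]
  rw [Finset.prod_congr rfl fun i _ => show (x i + n + 1 - (x i - n)).toNat = 2 * n + 1 by omega]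
  simp

theorem sum_cube {d : ℕ} {M : Type*} [AddCommMonoid M] (x : Fin d → ℤ) (n : ℕ)
    (F : (Fin d → ℤ) → M) : ∑ y ∈ cube (0 : Fin d → ℤ) n, F (y + x) = ∑ y ∈ cube x n, F y :=
  Finset.sum_equiv (Equiv.addRight x) (fun y => by simp [mem_cube]) fun _ _ => rfl

/-- The combinatorial core of the maximal inequality on `ℤ^d`, by Vitali's covering lemma. -/
theorem mul_card_le_of_forall_le_sum_cube {d : ℕ} (F : (Fin d → ℤ) → ℝ≥0∞) (c : ℝ≥0∞)
    (A T : Finset (Fin d → ℤ)) (r : (Fin d → ℤ) → ℕ)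
    (hr : ∀ x ∈ A, c * (2 * r x + 1) ^ d ≤ ∑ y ∈ cube x (r x), F y)
    (hT : ∀ x ∈ A, cube x (r x) ⊆ T) :
    c * A.card ≤ 3 ^ d * ∑ y ∈ T, F y := by
  classical
  obtain ⟨u, huA, hdisj, hcov⟩ := Vitali.exists_disjoint_subfamily_covering_enlargement
    (fun x => (cube x (r x) : Set (Fin d → ℤ))) (A : Set (Fin d → ℤ)) (fun x => (r x : ℝ)) 2
    one_lt_two (fun x _ => Nat.cast_nonneg _) (A.sup r : ℕ)
    (fun x hx => Nat.cast_le.2 (Finset.le_sup (f := r) hx))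
    (fun x _ => ⟨x, Finset.mem_coe.2 (mem_cube.2 fun i => by simp)⟩)
  lift u to Finset (Fin d → ℤ) using A.finite_toSet.subset huA
  -- The cube of `a` meets a selected cube with `r a ≤ 2 * r b`, so `a` lies within `3 * r b` of
  -- `b`. Only centres are counted, so the cubes of `A` themselves need not be covered.
  have hcard : A.card ≤ ∑ b ∈ u, (2 * (3 * r b) + 1) ^ d := by
    refine (Finset.card_le_card (t := u.biUnion fun b => cube b (3 * r b)) fun a ha => ?_).trans
      (Finset.card_biUnion_le.trans_eq (Finset.sum_congr rfl fun b _ => card_cube b _))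
    obtain ⟨b, hb, ⟨z, hza, hzb⟩, hab⟩ := hcov a ha
    rw [Finset.mem_coe, mem_cube] at hza hzb
    refine Finset.mem_biUnion.2 ⟨b, hb, mem_cube.2 fun i => ?_⟩
    have hab' : (r a : ℤ) ≤ 2 * r b := by exact_mod_cast hab
    have h₁ := abs_le.1 (hza i)
    have h₂ := abs_le.1 (hzb i)
    push_cast
    exact abs_le.2 ⟨by linarith, by linarith⟩
  calc c * A.card ≤ c * ∑ b ∈ u, 3 ^ d * (2 * r b + 1 : ℝ≥0∞) ^ d := by
        gcongr
        refine (Nat.cast_le.2 hcard).trans ?_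
        push_cast
        refine Finset.sum_le_sum fun b _ => ?_
        rw [← mul_pow]
        gcongr
        rw [mul_add, mul_left_comm]
        gcongr
        norm_num
    _ = 3 ^ d * ∑ b ∈ u, c * (2 * r b + 1 : ℝ≥0∞) ^ d := by
        simp only [Finset.mul_sum]
        exact Finset.sum_congr rfl fun b _ => mul_left_comm _ _ _
    _ ≤ 3 ^ d * ∑ b ∈ u, ∑ y ∈ cube b (r b), F y := by
        gcongr with b hb
        exact hr b (huA hb)
    _ = 3 ^ d * ∑ y ∈ u.biUnion fun b => cube b (r b), F y := by
        rw [Finset.sum_biUnion]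
        intro a ha b hb hab
        exact Finset.disjoint_coe.1 (hdisj ha hb hab)
    _ ≤ 3 ^ d * ∑ y ∈ T, F y := by
        gcongr
        exact Finset.biUnion_subset.2 fun b hb => hT b (huA hb)

instance (d : ℕ) : MeasurableConstVAdd (Fin d → ℤ) (Env d) where
  measurable_const_vadd a := measurable_pi_lambda _ fun e =>
    measurable_pi_apply (X := fun _ : Edge d => ℝ≥0∞) (Edge.shift a e)

/-- Wiener's maximal inequality for cubes in `ℤ^d`. -/
theorem mul_measure_exists_lt_sum_cube_le {d : ℕ} (P : Measure (Env d))
    [VAddInvariantMeasure (Fin d → ℤ) (Env d) P] {F : Env d → ℝ≥0∞} (hF : Measurable F)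
    (c : ℝ≥0∞) :
    c * P {ω | ∃ n : ℕ, c * (2 * n + 1) ^ d < ∑ y ∈ cube (0 : Fin d → ℤ) n, F (y +ᵥ ω)} ≤
      6 ^ d * ∫⁻ ω, F ω ∂P := by
  classical
  have hFy (y : Fin d → ℤ) : Measurable fun ω => F (y +ᵥ ω) := hF.comp (measurable_const_vadd y)
  -- Truncating the radius confines all cubes centred in `cube 0 N` to `cube 0 (2 * N)`.
  set E : ℕ → Set (Env d) := fun N =>
    {ω | ∃ n ≤ N, c * (2 * n + 1) ^ d < ∑ y ∈ cube (0 : Fin d → ℤ) n, F (y +ᵥ ω)} with hE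
  have hEm (N : ℕ) : MeasurableSet (E N) := by
    have : E N = ⋃ n, ⋃ _ : n ≤ N,
        {ω | c * (2 * n + 1) ^ d < ∑ y ∈ cube (0 : Fin d → ℤ) n, F (y +ᵥ ω)} := by
      ext; simp [hE]
    rw [this]
    exact MeasurableSet.iUnion fun n => MeasurableSet.iUnion fun _ =>
      measurableSet_lt measurable_const (Finset.measurable_sum _ fun y _ => hFy y)
  have hmono : Monotone E := fun N N' h ω ⟨n, hn, hω⟩ => ⟨n, hn.trans h, hω⟩
  have hunion : {ω : Env d | ∃ n : ℕ, c * (2 * n + 1 : ℝ≥0∞) ^ d <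
      ∑ y ∈ cube (0 : Fin d → ℤ) n, F (y +ᵥ ω)} = ⋃ N, E N := by
    ext ω
    simp only [hE, Set.mem_ofPred_eq, Set.mem_iUnion]
    exact ⟨fun ⟨n, hn⟩ => ⟨n, n, le_rfl, hn⟩, fun ⟨_, n, _, hn⟩ => ⟨n, hn⟩⟩
  rw [hunion, hmono.measure_iUnion, ENNReal.mul_iSup]
  refine iSup_le fun N => ?_
  -- Transference: the covering bound is applied along the orbit of a fixed `ω`. Integrating it and
  -- using invariance turns both sums into cardinalities of cubes times integrals.
  have hpt (ω : Env d) : ∑ x ∈ cube (0 : Fin d → ℤ) N, c * (E N).indicator 1 (x +ᵥ ω) ≤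
      3 ^ d * ∑ y ∈ cube (0 : Fin d → ℤ) (2 * N), F (y +ᵥ ω) := by
    set A := (cube (0 : Fin d → ℤ) N).filter fun x => x +ᵥ ω ∈ E N with hA
    have hex : ∀ x ∈ A, ∃ n ≤ N,
        c * (2 * n + 1) ^ d < ∑ y ∈ cube (0 : Fin d → ℤ) n, F (y +ᵥ x +ᵥ ω) :=
      fun x hx => (Finset.mem_filter.1 hx).2
    choose! r hrN hr using hex
    have h := mul_card_le_of_forall_le_sum_cube (fun y => F (y +ᵥ ω)) c A (cube 0 (2 * N)) r
      (fun x hx => by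
        rw [← sum_cube]
        simp only [add_vadd]
        exact (hr x hx).le)
      (fun x hx y hy => by
        rw [mem_cube] at hy ⊢
        intro i
        have h₁ := abs_le.1 (hy i)
        have h₂ := abs_le.1 (mem_cube.1 (Finset.mem_filter.1 hx).1 i)
        have h₃ : (r x : ℤ) ≤ N := by exact_mod_cast hrN x hx
        simp only [Pi.zero_apply, sub_zero] at h₂ ⊢
        push_cast
        exact abs_le.2 ⟨by linarith, by linarith⟩)
    refine le_trans (le_of_eq ?_) h
    rw [← Finset.mul_sum, hA, Finset.card_filter]
    push_cast
    congr 1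
    exact Finset.sum_congr rfl fun x _ => by simp [Set.indicator_apply]
  have hint := lintegral_mono hpt (μ := P)
  have hmeas (x : Fin d → ℤ) : Measurable fun ω => (E N).indicator (1 : Env d → ℝ≥0∞) (x +ᵥ ω) :=
    (measurable_one.indicator (hEm N)).comp (measurable_const_vadd x)
  rw [lintegral_finsetSum _ fun x _ => (hmeas x).const_mul c,
    lintegral_const_mul _ (Finset.measurable_sum _ fun y _ => hFy y),
    lintegral_finsetSum _ fun y _ => hFy y] at hint
  simp only [lintegral_const_mul _ (hmeas _),
    (measurePreserving_vadd _ P).lintegral_comp hF,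
    (measurePreserving_vadd _ P).lintegral_comp (measurable_one.indicator (hEm N)),
    lintegral_indicator_one (hEm N), Finset.sum_const, card_cube, nsmul_eq_mul] at hint
  -- The ratio of the two cubes is at most `2^d`; with the covering factor `3^d` this gives `6^d`.
  have hk : ((2 * (2 * N) + 1 : ℕ) ^ d : ℝ≥0∞) ≤ 2 ^ d * (2 * N + 1 : ℕ) ^ d := by
    rw [← mul_pow]
    gcongr
    norm_cast
    omega
  have h0 : ((2 * N + 1 : ℕ) ^ d : ℝ≥0∞) ≠ 0 := by positivity
  have htop : ((2 * N + 1 : ℕ) ^ d : ℝ≥0∞) ≠ ∞ := ENNReal.pow_ne_top (ENNReal.natCast_ne_top _)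
  refine (ENNReal.mul_le_mul_iff_right h0 htop).1 ?_
  push_cast at hint hk ⊢
  refine hint.trans ?_
  calc _ ≤ 3 ^ d * (2 ^ d * (2 * N + 1 : ℝ≥0∞) ^ d * ∫⁻ ω, F ω ∂P) := by gcongr
    _ = _ := by
      rw [show (6 : ℝ≥0∞) = 3 * 2 by norm_num, mul_pow]
      ring

/-- The sites in question lie in the cube of radius `n = ⌊1/ε⌋`, and `ε * (2 * n + 1) ≤ 3` when `ε ≤
1`. The weights enter only through their bound `C`, which makes the maximal inequality uniform over
families. -/
theorem abs_ergodicSum_le {d : ℕ} {ε : ℝ} {v : scaledLattice d ε → ℝ} (hε : 0 < ε) (hε1 : ε ≤ 1)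
    {C : ℝ} (hC0 : 0 ≤ C) (hC : ∀ z, |v z| ≤ C) {g : Env d → ℝ} {ω : Env d} {c : ℝ} (hc : 0 ≤ c)
    (hg : ∀ n : ℕ, ∑ y ∈ cube (0 : Fin d → ℤ) n, ‖g (y +ᵥ ω)‖ₑ ≤
      ENNReal.ofReal c * (2 * n + 1) ^ d) :
    |ergodicSum g ω ε v| ≤ C * 3 ^ d * c := by
  set n := ⌊1 / ε⌋₊ with hn
  have hnε : ε * n ≤ 1 := by
    rw [mul_comm, ← le_div_iff₀ hε]
    exact Nat.floor_le (by positivity)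
  have hsub : {x : Fin d → ℤ | scalePoint ε x ∈ discreteBox d ε} ⊆
      (cube (0 : Fin d → ℤ) n : Set (Fin d → ℤ)) := by
    intro x hx
    rw [Finset.mem_coe, mem_cube]
    intro i
    have hxi : -1 < ε * (x i : ℝ) ∧ ε * (x i : ℝ) < 1 := hx i trivial
    have : ((|x i| : ℤ) : ℝ) ≤ 1 / ε := by
      rw [le_div_iff₀ hε, Int.cast_abs, mul_comm, ← abs_of_pos hε, ← abs_mul]
      exact (abs_lt.2 hxi).le
    rw [Pi.zero_apply, sub_zero]
    rw [← Int.natCast_natAbs, Nat.cast_le, hn]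
    refine Nat.le_floor ?_
    rwa [Nat.cast_natAbs]
  have hreal : ∑ y ∈ cube (0 : Fin d → ℤ) n, |g (y +ᵥ ω)| ≤ c * (2 * n + 1) ^ d := by
    have h := hg n
    simp only [← ofReal_norm] at h
    rw [← ENNReal.ofReal_sum_of_nonneg fun _ _ => norm_nonneg _] at h
    have e : (ENNReal.ofReal c * (2 * n + 1) ^ d : ℝ≥0∞) =
        ENNReal.ofReal (c * (2 * n + 1) ^ d) := by
      rw [ENNReal.ofReal_mul hc, ENNReal.ofReal_pow (by positivity),
        ENNReal.ofReal_add (by positivity) zero_le_one, ENNReal.ofReal_mul zero_le_two]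
      simp
    rw [e, ENNReal.ofReal_le_ofReal_iff (by positivity)] at h
    exact h
  have hfin := finite_setOf_scalePoint_mem_discreteBox d hε
  rw [ergodicSum, finsum_mem_eq_finite_toFinset_sum _ hfin, abs_mul,
    abs_of_nonneg (pow_nonneg hε.le d)]
  calc ε ^ d * |∑ x ∈ hfin.toFinset, v (scalePoint ε x) * g (x +ᵥ ω)|
      ≤ ε ^ d * ∑ x ∈ hfin.toFinset, C * |g (x +ᵥ ω)| := by
        gcongr
        refine (Finset.abs_sum_le_sum_abs _ _).trans (Finset.sum_le_sum fun x _ => ?_)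
        rw [abs_mul]
        gcongr
        exact hC _
    _ ≤ ε ^ d * ∑ x ∈ cube (0 : Fin d → ℤ) n, C * |g (x +ᵥ ω)| := by
        gcongr
        intro x hx
        exact hsub (hfin.mem_toFinset.1 hx)
    _ ≤ ε ^ d * (C * (c * (2 * n + 1) ^ d)) := by
        rw [← Finset.mul_sum]
        gcongr
    _ = C * (ε * (2 * n + 1)) ^ d * c := by rw [mul_pow]; ring
    _ ≤ C * 3 ^ d * c := by
        gcongr
        linarith

/-! ### The class of good observables -/

/-- The conclusion of the ergodic theorem for the observable `f`. -/
def HasWeightedErgodicLimit {d : ℕ} (P : Measure (Env d)) (f : Env d → ℝ) : Prop :=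
  ∀ᵐ ω ∂P, ∀ (S : Set ℝ) (u : (ε : ℝ) → scaledLattice d ε → ℝ) (u₀ : (Fin d → ℝ) → ℝ),
    IsWeightFamily S u u₀ → Tendsto (fun ε => ergodicSum f ω ε (u ε)) (𝓝[S] 0)
      (𝓝 ((∫ ω', f ω' ∂P) * ∫ y in box d, u₀ y))

/-- Ergodic sums sample a whole orbit. It is countable and translations preserve null sets, so
changing `f` on a null set is harmless. -/
theorem ae_forall_vadd {d : ℕ} {P : Measure (Env d)} [VAddInvariantMeasure (Fin d → ℤ) (Env d) P]
    {p : Env d → Prop} (h : ∀ᵐ ω ∂P, p ω) : ∀ᵐ ω ∂P, ∀ x : Fin d → ℤ, p (x +ᵥ ω) :=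
  ae_all_iff.2 fun x => (measurePreserving_vadd x P).quasiMeasurePreserving.ae h

/-- A function that is a.e. invariant under an ergodic action is a.e. constant. -/
theorem ae_eq_const_of_forall_comp_vadd_ae_eq {G α : Type*} [VAdd G α] {_ : MeasurableSpace α}
    {μ : Measure α} [ErgodicVAdd G α μ] {h : α → ℝ} (hm : AEMeasurable h μ)
    (hinv : ∀ a : G, (fun ω => h (a +ᵥ ω)) =ᵐ[μ] h) : ∃ c, h =ᵐ[μ] fun _ => c := by
  refine exists_eventuallyEq_const_of_forall_separating MeasurableSet fun U hU => ?_
  have h₁ : EventuallyConst (h ⁻¹' U) (ae μ) := by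
    refine aeconst_of_forall_preimage_vadd_ae_eq G (hm.nullMeasurableSet_preimage hU) fun a => ?_
    filter_upwards [hinv a] with ω hω
    exact congrArg (· ∈ U) hω
  exact eventuallyConst_set.1 h₁

namespace HasWeightedErgodicLimit

variable {d : ℕ} {P : Measure (Env d)}

theorem congr [VAddInvariantMeasure (Fin d → ℤ) (Env d) P] {f g : Env d → ℝ}
    (hf : HasWeightedErgodicLimit P f) (hfg : f =ᵐ[P] g) : HasWeightedErgodicLimit P g := by
  filter_upwards [hf, ae_forall_vadd hfg] with ω h₁ h₂ S u u₀ hu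
  have h := h₁ S u u₀ hu
  rw [integral_congr_ae hfg] at h
  simpa only [ergodicSum, h₂] using h

theorem add {f g : Env d → ℝ} (hfi : Integrable f P) (hgi : Integrable g P)
    (hf : HasWeightedErgodicLimit P f) (hg : HasWeightedErgodicLimit P g) :
    HasWeightedErgodicLimit P (fun ω => f ω + g ω) := by
  filter_upwards [hf, hg] with ω h₁ h₂ S u u₀ hu
  rw [integral_add hfi hgi, add_mul]
  refine ((h₁ S u u₀ hu).add (h₂ S u u₀ hu)).congr' ?_
  filter_upwards [hu.eventually_mem] with ε hε
  exact (ergodicSum_add f g ω (hu.pos hε)).symm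

theorem const_mul {f : Env d → ℝ} (hf : HasWeightedErgodicLimit P f) (c : ℝ) :
    HasWeightedErgodicLimit P (fun ω => c * f ω) := by
  filter_upwards [hf] with ω h₁ S u u₀ hu
  rw [integral_const_mul, mul_assoc]
  simpa only [ergodicSum_const_mul] using (h₁ S u u₀ hu).const_mul c

theorem const [IsProbabilityMeasure P] (c : ℝ) : HasWeightedErgodicLimit P (fun _ => c) :=
  Eventually.of_forall fun ω S u u₀ hu => by simpa using hu.tendsto_ergodicSum_const c ω

theorem coboundary [VAddInvariantMeasure (Fin d → ℤ) (Env d) P] {g : Env d → ℝ}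
    (hgi : Integrable g P) {M : ℝ} (hM : ∀ ω, |g ω| ≤ M) (a : Fin d → ℤ) :
    HasWeightedErgodicLimit P (fun ω => g (a +ᵥ ω) - g ω) :=
  Eventually.of_forall fun ω S u u₀ hu => by
    have hga : Integrable (fun ω => g (a +ᵥ ω)) P :=
      (measurePreserving_vadd a P).integrable_comp_of_integrable hgi
    rw [integral_sub hga hgi, integral_vadd_eq_self g, sub_self, zero_mul]
    exact hu.tendsto_ergodicSum_coboundary hM a ω

/-- The functions satisfying the ergodic theorem are closed under `L¹` approximation. -/
theorem of_forall_approx [IsProbabilityMeasure P] [VAddInvariantMeasure (Fin d → ℤ) (Env d) P]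
    {f : Env d → ℝ} (hf : Integrable f P)
    (happ : ∀ δ : ℝ, 0 < δ → ∃ g, Integrable g P ∧ HasWeightedErgodicLimit P g ∧
      ∫ ω, |f ω - g ω| ∂P ≤ δ) :
    HasWeightedErgodicLimit P f := by
  set c : ℕ → ℝ := fun k => (1 / 2) ^ k with hc
  have hcpos (k : ℕ) : 0 < c k := by positivity
  -- An `L¹` error `c k ^ 2` against the threshold `c k` leaves an exceptional set of measure at
  -- most `6^d * c k`, which is summable.
  choose g hgi hg hfg using fun k => happ (c k * c k) (mul_pos (hcpos k) (hcpos k))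
  have hsub (k : ℕ) : Integrable (fun ω => f ω - g k ω) P := hf.sub (hgi k)
  have hm (k : ℕ) : AEMeasurable (fun ω => ‖f ω - g k ω‖ₑ) P :=
    (hsub k).aestronglyMeasurable.enorm
  -- The maximal inequality needs a measurable function, so a measurable version is used; the two
  -- agree along almost every orbit.
  set F : ℕ → Env d → ℝ≥0∞ := fun k => (hm k).mk
  set E : ℕ → Set (Env d) := fun k =>
    {ω | ∃ n : ℕ, ENNReal.ofReal (c k) * (2 * n + 1) ^ d <
      ∑ y ∈ cube (0 : Fin d → ℤ) n, F k (y +ᵥ ω)}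
  have hE (k : ℕ) : P (E k) ≤ 6 ^ d * ENNReal.ofReal (c k) := by
    have h₁ := mul_measure_exists_lt_sum_cube_le P (hm k).measurable_mk (ENNReal.ofReal (c k))
    have h₂ : ∫⁻ ω, F k ω ∂P ≤ ENNReal.ofReal (c k) * ENNReal.ofReal (c k) := by
      rw [lintegral_congr_ae (hm k).ae_eq_mk.symm, ← ENNReal.ofReal_mul (hcpos k).le,
        ← ofReal_integral_norm_eq_lintegral_enorm (hsub k)]
      exact ENNReal.ofReal_le_ofReal (hfg k)
    have h0 : ENNReal.ofReal (c k) ≠ 0 := (ENNReal.ofReal_pos.2 (hcpos k)).ne'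
    refine (ENNReal.mul_le_mul_iff_right h0 ENNReal.ofReal_ne_top).1 (h₁.trans ?_)
    rw [mul_left_comm]
    gcongr
  have hsum : ∑' k, P (E k) ≠ ∞ := by
    refine ne_top_of_le_ne_top ?_ (ENNReal.tsum_le_tsum hE)
    rw [ENNReal.tsum_mul_left]
    exact ENNReal.mul_ne_top (ENNReal.pow_ne_top (by norm_num))
      (summable_geometric_two.tsum_ofReal_ne_top)
  filter_upwards [ae_eventually_notMem hsum, ae_all_iff.2 hg,
    ae_all_iff.2 fun k => ae_forall_vadd (hm k).ae_eq_mk] with ω hωE hωg hωF S u u₀ hu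
  obtain ⟨C, hC0, hC⟩ := hu.exists_bound
  set I := ∫ y in box d, u₀ y
  rw [Metric.tendsto_nhds]
  intro η hη
  have hsmall : Tendsto (fun k => (C * 3 ^ d + |I|) * c k) atTop (𝓝 0) := by
    simpa only [mul_zero] using
      (tendsto_pow_atTop_nhds_zero_of_lt_one (by norm_num : (0 : ℝ) ≤ 1 / 2)
      (by norm_num)).const_mul (C * 3 ^ d + |I|)
  obtain ⟨k, hk, hkE⟩ := ((hsmall.eventually_lt_const (half_pos hη)).and hωE).exists
  have hcube (n : ℕ) : ∑ y ∈ cube (0 : Fin d → ℤ) n, ‖f (y +ᵥ ω) - g k (y +ᵥ ω)‖ₑ ≤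
      ENNReal.ofReal (c k) * (2 * n + 1) ^ d := by
    simp only [hωF k]
    exact not_lt.1 fun h => hkE ⟨n, h⟩
  have hck : c k ≤ 1 := pow_le_one₀ (by norm_num) (by norm_num)
  have hmean : |∫ ω', g k ω' ∂P - ∫ ω', f ω' ∂P| ≤ c k := by
    rw [abs_sub_comm, ← integral_sub hf (hgi k)]
    refine (norm_integral_le_integral_norm fun ω => f ω - g k ω).trans ((hfg k).trans ?_)
    exact mul_le_of_le_one_left (hcpos k).le hck
  filter_upwards [Metric.tendsto_nhds.1 (hωg k S u u₀ hu) (η / 2) (half_pos hη),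
    hu.eventually_mem, nhdsWithin_le_nhds (Iic_mem_nhds (zero_lt_one (α := ℝ)))] with ε h₁ hε hε1
  have h₂ := abs_ergodicSum_le (hu.pos hε) hε1 hC0 (hC ε hε) (hcpos k).le hcube
    (g := fun ω => f ω - g k ω)
  have h₃ : ergodicSum f ω ε (u ε) = ergodicSum (g k) ω ε (u ε) +
      ergodicSum (fun ω => f ω - g k ω) ω ε (u ε) := by
    rw [← ergodicSum_add _ _ _ (hu.pos hε)]
    simp only [add_sub_cancel]
  rw [Real.dist_eq] at h₁ ⊢
  have h₄ : |(∫ ω', g k ω' ∂P - ∫ ω', f ω' ∂P) * I| ≤ c k * |I| := by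
    rw [abs_mul]
    gcongr
  calc |ergodicSum f ω ε (u ε) - (∫ ω', f ω' ∂P) * I|
      = |(ergodicSum (g k) ω ε (u ε) - (∫ ω', g k ω' ∂P) * I) +
          (ergodicSum (fun ω => f ω - g k ω) ω ε (u ε) +
            (∫ ω', g k ω' ∂P - ∫ ω', f ω' ∂P) * I)| := by rw [h₃]; congr 1; ring
    _ ≤ _ := abs_add_le _ _
    _ ≤ _ := add_le_add_right (abs_add_le _ _) _
    _ < η := by linarith

/-- On a probability space the `Lᵖ` norm dominates the `L¹` norm. The exponent `2` serves the
Hilbert space argument, and `1` the final density step. -/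
theorem isClosed_setOf [IsProbabilityMeasure P] [VAddInvariantMeasure (Fin d → ℤ) (Env d) P]
    (p : ℝ≥0∞) [hp : Fact (1 ≤ p)] :
    IsClosed {h : Lp ℝ p P | HasWeightedErgodicLimit P h} := by
  refine isClosed_of_closure_subset fun h hh => ?_
  refine of_forall_approx ((Lp.memLp h).integrable hp.out) fun δ hδ => ?_
  obtain ⟨k, hk, hhk⟩ := Metric.mem_closure_iff.1 hh δ hδ
  refine ⟨k, (Lp.memLp k).integrable hp.out, hk, le_trans ?_ hhk.le⟩
  have hsub : ∫ ω, |h ω - k ω| ∂P = ∫ ω, ‖(h - k : Lp ℝ p P) ω‖ ∂P :=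
    integral_congr_ae <| (Lp.coeFn_sub h k).mono fun ω hω => by
      simp only [hω, Pi.sub_apply, Real.norm_eq_abs]
  rw [hsub, dist_eq_norm, Lp.norm_def, integral_norm_eq_lintegral_enorm
    (Lp.aestronglyMeasurable _), ← eLpNorm_one_eq_lintegral_enorm]
  exact ENNReal.toReal_mono (Lp.eLpNorm_ne_top _)
    (eLpNorm_le_eLpNorm_of_exponent_le hp.out (Lp.aestronglyMeasurable _))

/-! ### Orthogonality in `L²` and density in `L¹` -/

/-- The square-integrable functions satisfying the ergodic theorem. -/
noncomputable def submodule (P : Measure (Env d)) [IsProbabilityMeasure P]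
    [VAddInvariantMeasure (Fin d → ℤ) (Env d) P] : Submodule ℝ (Lp ℝ 2 P) where
  carrier := {h | HasWeightedErgodicLimit P h}
  zero_mem' := (const (P := P) 0).congr (Lp.coeFn_zero ℝ 2 P).symm
  add_mem' {h k} hh hk := (hh.add ((Lp.memLp h).integrable one_le_two)
    ((Lp.memLp k).integrable one_le_two) hk).congr (Lp.coeFn_add h k).symm
  smul_mem' c h hh := (hh.const_mul c).congr (Lp.coeFn_smul c h).symm

/-- Orthogonality to the coboundaries of indicators forces invariance, ergodicity then gives a
constant, and orthogonality to `1` makes it zero. -/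
theorem submodule_orthogonal_eq_bot [IsProbabilityMeasure P]
    [ErgodicVAdd (Fin d → ℤ) (Env d) P] : (submodule P)ᗮ = ⊥ := by
  rw [Submodule.eq_bot_iff]
  intro h hh
  have hint : Integrable h P := (Lp.memLp h).integrable one_le_two
  have hpre (a : Fin d → ℤ) {s : Set (Env d)} (hs : MeasurableSet s) :
      ∫ ω in (a +ᵥ ·) ⁻¹' s, h ω ∂P = ∫ ω in s, h ω ∂P := by
    have hs' : MeasurableSet ((a +ᵥ ·) ⁻¹' s : Set (Env d)) := measurable_const_vadd a hs
    have hmem : indicatorConstLp 2 hs' (measure_ne_top P _) (1 : ℝ) -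
        indicatorConstLp 2 hs (measure_ne_top P _) 1 ∈ submodule P := by
      refine (coboundary (g := s.indicator fun _ => (1 : ℝ)) (M := 1)
        ((integrable_const _).indicator hs) (fun ω => ?_) a).congr ?_
      · by_cases hω : ω ∈ s <;> simp [hω]
      · filter_upwards [Lp.coeFn_sub (indicatorConstLp 2 hs' (measure_ne_top P _) (1 : ℝ))
          (indicatorConstLp 2 hs (measure_ne_top P _) 1),
          indicatorConstLp_coeFn (p := 2) (hs := hs') (hμs := measure_ne_top P _) (c := (1 : ℝ)),
          indicatorConstLp_coeFn (p := 2) (hs := hs) (hμs := measure_ne_top P _) (c := (1 : ℝ))]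
          with ω h₁ h₂ h₃
        rw [h₁, Pi.sub_apply, h₂, h₃]
        rfl
    have h0 := (Submodule.mem_orthogonal _ _).1 hh _ hmem
    rwa [inner_sub_left, L2.inner_indicatorConstLp_one, L2.inner_indicatorConstLp_one,
      sub_eq_zero] at h0
  have hinv (a : Fin d → ℤ) : (fun ω => h (a +ᵥ ω)) =ᵐ[P] h := by
    have hi : Integrable (fun ω => h (a +ᵥ ω)) P :=
      (measurePreserving_vadd a P).integrable_comp_of_integrable hint
    refine hi.ae_eq_of_forall_setIntegral_eq _ _ hint fun t ht _ => ?_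
    -- With `t` written as the preimage of `s` under `τ_a`, both integrals over `t` equal the
    -- integral of `h` over `s`: one by orthogonality, the other by invariance of `P`.
    set s : Set (Env d) := (-a +ᵥ ·) ⁻¹' t with hs
    have hsm : MeasurableSet s := measurable_const_vadd (-a) ht
    have hst : (a +ᵥ ·) ⁻¹' s = t := by ext ω; simp [hs]
    rw [← hst, hpre a hsm]
    exact (measurePreserving_vadd a P).setIntegral_preimage_emb
      (measurableEmbedding_const_vadd a) h s
  obtain ⟨c, hc⟩ := ae_eq_const_of_forall_comp_vadd_ae_eq
    (Lp.aestronglyMeasurable h).aemeasurable hinv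
  have hone : indicatorConstLp 2 MeasurableSet.univ (measure_ne_top P _) (1 : ℝ) ∈ submodule P := by
    refine (const (P := P) 1).congr (EventuallyEq.symm ?_)
    simpa using indicatorConstLp_coeFn (p := 2) (hs := MeasurableSet.univ)
      (hμs := measure_ne_top P _) (c := (1 : ℝ))
  have h0 := (Submodule.mem_orthogonal _ _).1 hh _ hone
  rw [L2.inner_indicatorConstLp_one, setIntegral_univ, integral_congr_ae hc] at h0
  simp only [integral_const, probReal_univ, one_smul] at h0
  subst h0
  exact (Lp.eq_zero_iff_ae_eq_zero).2 hc

theorem of_memLp_two [IsProbabilityMeasure P] [ErgodicVAdd (Fin d → ℤ) (Env d) P] {f : Env d → ℝ}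
    (hf : MemLp f 2 P) : HasWeightedErgodicLimit P f := by
  have hcl : IsClosed (submodule P : Set (Lp ℝ 2 P)) := isClosed_setOf 2
  have : CompleteSpace (submodule P) := hcl.completeSpace_coe
  have htop : submodule P = ⊤ := Submodule.orthogonal_eq_bot_iff.1 submodule_orthogonal_eq_bot
  have hmem : hf.toLp f ∈ submodule P := htop ▸ Submodule.mem_top
  exact congr hmem hf.coeFn_toLp

/-- Indicators of measurable sets are in `L²`; additivity and closedness in `L¹` do the rest. -/
theorem of_integrable [IsProbabilityMeasure P] [ErgodicVAdd (Fin d → ℤ) (Env d) P]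
    {f : Env d → ℝ} (hf : Integrable f P) : HasWeightedErgodicLimit P f := by
  refine hf.induction (HasWeightedErgodicLimit P) (fun c s hs _ => ?_)
    (fun f g _ hfi hgi h₁ h₂ => h₁.add hfi hgi h₂) (isClosed_setOf 1)
    (fun f g hfg _ h => h.congr hfg)
  exact of_memLp_two (memLp_indicator_const 2 hs c (Or.inr (measure_ne_top P s)))

end HasWeightedErgodicLimit

end RandomConductance

theorem mainTheorem10 (d : ℕ) (P : Measure (Env d)) [IsProbabilityMeasure P]
    [ErgodicVAdd (Fin d → ℤ) (Env d) P] (f : Env d → ℝ) (hf : Integrable f P) :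
    ∀ᵐ ω ∂P, ∀ (S : Set ℝ), S ⊆ Set.Ioi 0 → (𝓝[S] (0 : ℝ)).NeBot →
      ∀ (u : (ε : ℝ) → scaledLattice d ε → ℝ) (u₀ : (Fin d → ℝ) → ℝ),
        (∀ ε ∈ S, Function.support (u ε) ⊆ discreteBox d ε) →
        (∀ᵐ y ∂(volume.restrict (box d)),
          Tendsto (fun ε => cellExtend ε (u ε) y) (𝓝[S] 0) (𝓝 (u₀ y))) →
        (∃ C : ℝ, ∀ ε ∈ S, ∀ z : scaledLattice d ε, |u ε z| ≤ C) →
        MemLp u₀ ∞ (volume.restrict (box d)) ∧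
          Tendsto (fun ε => ergodicSum f ω ε (u ε)) (𝓝[S] 0)
            (𝓝 ((∫ ω', f ω' ∂P) * ∫ y in box d, u₀ y)) := by
  filter_upwards [HasWeightedErgodicLimit.of_integrable hf] with ω hω S hS hne u u₀ hsupp hlim hbdd
  have h : IsWeightFamily S u u₀ := ⟨hS, hne, hsupp, hlim, hbdd⟩
  exact ⟨h.memLp_top, hω S u u₀ h⟩
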